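/- Let $U\subseteq\mathbb{R}^n$ be open, let $f:U\to\mathbb{R}^n$, $g:U\to\mathbb{R}^{n\times m}$ and $u^+,u^-:U\to\mathbb{R}^m$ be continuously differentiable, and let $H:U\to\mathbb{R}$ be continuously differentiable with $0$ as a regular value, i.e. $\nabla H(x)\neq 0$ on $\Sigma:=\{x\in U: H(x)=0\}$. Put $\mathcal{S}^+:=\{x\in U: H(x)>0\}$, $\mathcal{S}^-:=\{x\in U: H(x)<0\}$, and let $\bar{\mathcal S}^\pm$ be the closures of $\mathcal S^\pm$ in $U$. Consider the closed-loop system $$\dot x=f(x)+g(x)\,u(x),\qquad u(x)=\begin{cases}u^+(x)&\text{if }H(x)>0,\\ u^-(x)&\text{if }H(x)<0,\end{cases}$$ with solutions in the sense of Filippov: locally absolutely continuous $x:[t_0,\infty)\to U$ such that for almost every $t\ge t_0$ the derivative $\dot x(t)$ exists and lies in the smallest closed convex set containing all limit values of $f(z)+g(z)u(z)$ as $z\to x(t)$, $z\in\mathcal S^+\cup\mathcal S^-$. Let $|\cdot|$ be a norm on $\mathbb{R}^n$, $\|\cdot\|$ the induced matrix norm and $\mu(A)=\lim_{h\to0^+}\frac{\|I+hA\|-1}{h}$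 the associated matrix measure. Let $\mathcal{C}\subseteq U$ be $K$-reachable for some $K>0$, i.e. any $x_0,y_0\in\mathcal C$ are joined by a $C^1$ curve $\gamma:[0,1]\to\mathcal C$ with $\gamma(0)=x_0$, $\gamma(1)=y_0$ and $|\gamma'(r)|\le K|y_0-x_0|$ for all $r$. Let $\mathcal C$ be forward invariant: for every $t_0$ and every $x_0\in\mathcal C$ there is a Filippov solution on $[t_0,\infty)$ with $x(t_0)=x_0$, and all such solutions stay in $\mathcal C$. Suppose that for some constants $c_1,c_2>0$ $$\mu\Big(\frac{\partial f}{\partial x}(x)+\frac{\partial}{\partial x}\big[g(x)u^+(x)\big]\Big)\le -c_1\quad\forall x\in\bar{\mathcal S}^+,$$ $$\mu\Big(\frac{\partial f}{\partial x}(x)+\frac{\partial}{\partial x}\big[g(x)u^-(x)\big]\Big)\le -c_2\quad\forall x\in\bar{\mathcal S}^-,$$ $$\mu\Big(g(x)\big[u^+(x)-u^-(x)\big]\,\nabla H(x)\Big)=0\quad\forall x\in\Sigma,$$ where $\nabla H(x)$ is a row vector. Then the closed-loop system is incrementally exponentially stable in $\mathcal C$ with rate $c:=\min\{c_1,c_2\}$: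 there is $K'\ge1$ such that for every $t_0$ and any two Filippov solutions $x,y$ on $[t_0,\infty)$ with $x(t_0),y(t_0)\in\mathcal C$, $$|x(t)-y(t)|\le K'e^{-c(t-t_0)}|x(t_0)-y(t_0)|\qquad\forall t\ge t_0.$$ -/

import Mathlib

open Set Filter Topology MeasureTheory

noncomputable section

namespace SwitchedControl

/-! ## Norms, induced matrix norms, matrix measures, K-reachable sets -/

/-- `N` is a norm on `ℝⁿ`: a seminorm that vanishes only at the origin. -/
def IsNorm {n : ℕ} (N : Seminorm ℝ (Fin n → ℝ)) : Prop :=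
  ∀ x, N x = 0 → x = 0

/-- The matrix norm induced by the vector norm `N`: the supremum of `N (A x)` over the closed unit
ball of `N` (a nonempty set, on which `N (A x)` is bounded whenever `N` is a norm). -/
def inducedNorm {n : ℕ} (N : Seminorm ℝ (Fin n → ℝ)) (A : Matrix (Fin n) (Fin n) ℝ) : ℝ :=
  sSup ((fun x => N (A.mulVec x)) '' {x | N x ≤ 1})

/-- The matrix measure (logarithmic norm) associated with the vector norm `N`:
`μ(A) = lim_{h → 0⁺} (‖I + h A‖ - 1) / h`. For a norm `N` on `ℝⁿ`, `n ≥ 1`, the limit exists for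
every `A`, because the quotient is monotone in `h > 0` and bounded below by `-‖A‖`. -/
def matrixMeasure {n : ℕ} (N : Seminorm ℝ (Fin n → ℝ)) (A : Matrix (Fin n) (Fin n) ℝ) : ℝ :=
  limUnder (𝓝[>] (0 : ℝ)) (fun h : ℝ => (inducedNorm N (1 + h • A) - 1) / h)

/-- `C` is `K`-reachable with respect to `N`: any two of its points are joined by a continuously
differentiable curve in `C` whose speed is at most `K` times the distance of the end points. -/
def IsKReachable {n : ℕ} (N : Seminorm ℝ (Fin n → ℝ)) (K : ℝ) (C : Set (Fin n → ℝ)) : Prop :=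
  ∀ x₀ ∈ C, ∀ y₀ ∈ C, ∃ γ : ℝ → Fin n → ℝ,
    ContDiffOn ℝ 1 γ (Icc 0 1) ∧ MapsTo γ (Icc 0 1) C ∧ γ 0 = x₀ ∧ γ 1 = y₀ ∧
    ∀ r ∈ Icc (0 : ℝ) 1, N (derivWithin γ (Icc 0 1) r) ≤ K * N (y₀ - x₀)

/-! ## Jacobians and gradients -/

/-- The Jacobian matrix `∂F/∂x` at `x`. -/
def jacobian {n : ℕ} (F : (Fin n → ℝ) → Fin n → ℝ) (x : Fin n → ℝ) :
    Matrix (Fin n) (Fin n) ℝ :=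
  LinearMap.toMatrix' (fderiv ℝ F x : (Fin n → ℝ) →ₗ[ℝ] (Fin n → ℝ))

/-- The gradient `∇H` at `x`, as the row of partial derivatives. -/
def grad {n : ℕ} (H : (Fin n → ℝ) → ℝ) (x : Fin n → ℝ) : Fin n → ℝ :=
  fun j => fderiv ℝ H x (Pi.single j 1)

/-! ## The switching manifold and the two regions -/

/-- The switching manifold `Σ = {x ∈ U : H x = 0}`. -/
def switchingManifold {n : ℕ} (U : Set (Fin n → ℝ)) (H : (Fin n → ℝ) → ℝ) : Set (Fin n → ℝ) :=
  {x | x ∈ U ∧ H x = 0}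

/-- The region `S⁺ = {x ∈ U : H x > 0}`. -/
def regionPos {n : ℕ} (U : Set (Fin n → ℝ)) (H : (Fin n → ℝ) → ℝ) : Set (Fin n → ℝ) :=
  {x | x ∈ U ∧ 0 < H x}

/-- The region `S⁻ = {x ∈ U : H x < 0}`. -/
def regionNeg {n : ℕ} (U : Set (Fin n → ℝ)) (H : (Fin n → ℝ) → ℝ) : Set (Fin n → ℝ) :=
  {x | x ∈ U ∧ H x < 0}

/-! ## The closed loop -/

/-- The switching feedback: `u⁺` where `H > 0` and `u⁻` where `H < 0`. The feedback is not specified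
where `H = 0`; the value `0` written there is never used, see `filippovMap`. -/
def switchingControl {n m : ℕ} (H : (Fin n → ℝ) → ℝ) (uPos uNeg : (Fin n → ℝ) → Fin m → ℝ) :
    (Fin n → ℝ) → Fin m → ℝ :=
  fun x => if 0 < H x then uPos x else if H x < 0 then uNeg x else 0

/-- The closed-loop vector field `f(x) + g(x) u(x)`. -/
def closedLoop {n m : ℕ} (f : (Fin n → ℝ) → Fin n → ℝ)
    (g : (Fin n → ℝ) → Matrix (Fin n) (Fin m) ℝ) (u : (Fin n → ℝ) → Fin m → ℝ) :
    (Fin n → ℝ) → Fin n → ℝ :=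
  fun x => f x + (g x).mulVec (u x)

/-! ## Filippov solutions and incremental stability -/

/-- Filippov's convexification of a piecewise continuous vector field `F` given on `D` (the domain
without the discontinuity set): the smallest closed convex set that contains all limit values of
`F y` as `y → x`, `y ∈ D`. -/
def filippovMap {n : ℕ} (D : Set (Fin n → ℝ)) (F : (Fin n → ℝ) → Fin n → ℝ) (x : Fin n → ℝ) :
    Set (Fin n → ℝ) :=
  closedConvexHull ℝ {v | MapClusterPt v (𝓝[D] x) F}

/-- `x` is a Filippov solution in `U`, on `[t₀, ∞)`, of `ẋ = F x` with `F` given on `D ⊆ U`: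
it takes values in `U`, is locally absolutely continuous, and for almost every `t ≥ t₀` it has a
derivative that lies in the Filippov set at `x t`. -/
structure IsFilippovSolution {n : ℕ} (U D : Set (Fin n → ℝ)) (F : (Fin n → ℝ) → Fin n → ℝ)
    (t₀ : ℝ) (x : ℝ → Fin n → ℝ) : Prop where
  mem : ∀ t, t₀ ≤ t → x t ∈ U
  absolutelyContinuous : ∀ T, t₀ ≤ T → AbsolutelyContinuousOnInterval x t₀ T
  inclusion : ∀ᵐ t ∂(volume.restrict (Ici t₀)), ∃ v ∈ filippovMap D F (x t), HasDerivAt x v t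

/-- The Filippov solutions in `U` of the control system with the switching feedback; the
discontinuous vector field is given on `S⁺ ∪ S⁻ = U \ Σ`. -/
def IsClosedLoopSolution {n m : ℕ} (U : Set (Fin n → ℝ)) (f : (Fin n → ℝ) → Fin n → ℝ)
    (g : (Fin n → ℝ) → Matrix (Fin n) (Fin m) ℝ) (uPos uNeg : (Fin n → ℝ) → Fin m → ℝ)
    (H : (Fin n → ℝ) → ℝ) (t₀ : ℝ) (x : ℝ → Fin n → ℝ) : Prop :=
  IsFilippovSolution U (regionPos U H ∪ regionNeg U H)
    (closedLoop f g (switchingControl H uPos uNeg)) t₀ x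

/-- `C` is forward invariant for the system whose solutions on `[t₀, ∞)` are given by `Sol t₀`:
from every point of `C` a solution exists for all later times, and all solutions that start in `C`
stay in `C`. -/
def IsForwardInvariant {n : ℕ} (Sol : ℝ → (ℝ → Fin n → ℝ) → Prop) (C : Set (Fin n → ℝ)) : Prop :=
  ∀ t₀ : ℝ, ∀ x₀ ∈ C, (∃ x, Sol t₀ x ∧ x t₀ = x₀) ∧
    ∀ x, Sol t₀ x → x t₀ = x₀ → ∀ t, t₀ ≤ t → x t ∈ C

/-- The system whose solutions on `[t₀, ∞)` are given by `Sol t₀` is incrementally exponentially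
stable in the forward invariant set `C`, in the norm `N`, with rate `lam > 0`. -/
def IsIncrementallyExpStable {n : ℕ} (N : Seminorm ℝ (Fin n → ℝ))
    (Sol : ℝ → (ℝ → Fin n → ℝ) → Prop) (C : Set (Fin n → ℝ)) (lam : ℝ) : Prop :=
  IsForwardInvariant Sol C ∧ 0 < lam ∧ ∃ K : ℝ, 1 ≤ K ∧
    ∀ t₀ : ℝ, ∀ x y : ℝ → Fin n → ℝ, Sol t₀ x → Sol t₀ y → x t₀ ∈ C → y t₀ ∈ C →
      ∀ t, t₀ ≤ t → N (x t - y t) ≤ K * Real.exp (-lam * (t - t₀)) * N (x t₀ - y t₀)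

end SwitchedControl

end

/-! If `ℓ` is a subgradient of the norm at `z`, then `ℓ (A z) ≤ μ(A) N z`. The two measure bounds
therefore say that each branch contracts at rate `c` in its own closed region. For the rank-one
matrix, the condition says that `(∇H z) · ℓ (g (u⁺ - u⁻) z-independent) ≤ 0` in the sense that the
jump of the field, seen through `ℓ`, never has the sign of the crossing.

Locally, fix `ℓ` supporting `x - y` and follow `ℓ` of the field along the segment from `y` to `x`.
It grows at rate at most `-c N (x - y)` away from the switching manifold and never jumps up on it,
however often the segment meets it (`IsPiecewiseContracting.apply_sub_le`). Shifting endpoints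
transversally and pairing the branches extends this to all Filippov velocities, as the dissipativity
inequality `IsPiecewiseContracting.dissipative`. Along two nearby solutions this gives `d/dt N ≤ -c
N` almost everywhere, and absolute continuity integrates it (`IsFilippovSolution.exp_mul_le`).

The estimate is only local, since a long segment may leave `U`. Each solution thus contracts its
neighbours in a tube (`IsFilippovSolution.exists_tube`), and a curve of initial points in the
reachable set carries the estimate to distant solutions, at the cost of the factor `K`. -/

namespace SwitchedControl

/-! ## Supporting functionals and norm equivalence -/

/-- `ℓ` is a subgradient of the seminorm `N` at `z`. -/
def IsSupporting {E : Type*} [AddCommGroup E] [Module ℝ E] (N : Seminorm ℝ E) (z : E)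
    (ℓ : E →ₗ[ℝ] ℝ) : Prop :=
  (∀ w, ℓ w ≤ N w) ∧ ℓ z = N z

/-- Hahn–Banach: the functional `c z ↦ c N z` on the line through `z` extends under the domination
by `N`. -/
theorem exists_isSupporting {E : Type*} [AddCommGroup E] [Module ℝ E] (N : Seminorm ℝ E) (z : E) :
    ∃ ℓ, IsSupporting N z ℓ := by
  rcases eq_or_ne z 0 with rfl | hz
  · exact ⟨0, fun w => by simp, by simp⟩
  obtain ⟨g, hg, hgN⟩ := exists_extension_of_le_sublinear
    (LinearPMap.mkSpanSingleton (K := ℝ) z (N z) hz) N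
    (fun c hc x => by rw [map_smul_eq_mul, Real.norm_of_nonneg hc.le])
    (fun x y => map_add_le_add N x y) (by
      rintro ⟨x, hx⟩
      obtain ⟨c, rfl⟩ := Submodule.mem_span_singleton.1 hx
      refine (LinearPMap.mkSpanSingleton'_apply (σ := RingHom.id ℝ) z (N z) _ c hx).trans_le ?_
      rw [map_smul_eq_mul, smul_eq_mul]
      exact mul_le_mul_of_nonneg_right (le_abs_self c) (apply_nonneg N z))
  refine ⟨g, hgN, ?_⟩
  have := hg ⟨z, Submodule.mem_span_singleton_self z⟩
  rwa [LinearPMap.mkSpanSingleton_apply] at this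

variable {n : ℕ} {N : Seminorm ℝ (Fin n → ℝ)}

theorem exists_seminorm_le (N : Seminorm ℝ (Fin n → ℝ)) :
    ∃ M : ℝ, 0 < M ∧ ∀ x, N x ≤ M * ‖x‖ := by
  refine ⟨∑ i, N (Pi.single i 1) + 1, by positivity, fun x => ?_⟩
  calc N x = N (∑ i, x i • (Pi.single i 1 : Fin n → ℝ)) := by
        congr 1
        exact pi_eq_sum_univ' x
    _ ≤ ∑ i, N (x i • (Pi.single i 1 : Fin n → ℝ)) :=
        Finset.le_sum_of_subadditive N (map_zero N).le (map_add_le_add N) _ _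
    _ ≤ ∑ i, N (Pi.single i 1) * ‖x‖ := by
        refine Finset.sum_le_sum fun i _ => ?_
        rw [map_smul_eq_mul, mul_comm]
        exact mul_le_mul_of_nonneg_left (norm_le_pi_norm x i) (apply_nonneg N _)
    _ ≤ _ := by
        rw [← Finset.sum_mul, add_mul]
        linarith [norm_nonneg x]

theorem abs_seminorm_sub_le (N : Seminorm ℝ (Fin n → ℝ)) (x y : Fin n → ℝ) :
    |N x - N y| ≤ N (x - y) := by
  have h1 := map_add_le_add N (x - y) y
  have h2 := map_add_le_add N (y - x) x
  rw [map_sub_rev N y x] at h2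
  simp only [sub_add_cancel] at h1 h2
  exact abs_sub_le_iff.2 ⟨by linarith, by linarith⟩

theorem continuous_seminorm (N : Seminorm ℝ (Fin n → ℝ)) : Continuous N := by
  obtain ⟨M, hM, hN⟩ := exists_seminorm_le N
  refine (LipschitzWith.of_dist_le_mul (K := ⟨M, hM.le⟩) fun x y => ?_).continuous
  rw [Real.dist_eq, dist_eq_norm]
  exact (abs_seminorm_sub_le N x y).trans (hN _)

theorem IsNorm.exists_le (hN : IsNorm N) : ∃ m : ℝ, 0 < m ∧ ∀ x, m * ‖x‖ ≤ N x := by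
  rcases (Metric.sphere (0 : Fin n → ℝ) 1).eq_empty_or_nonempty with h | h
  · refine ⟨1, one_pos, fun x => ?_⟩
    rcases eq_or_ne x 0 with rfl | hx
    · simp
    have : (‖x‖⁻¹ • x) ∈ Metric.sphere (0 : Fin n → ℝ) 1 := by
      simp [norm_smul, norm_ne_zero_iff.2 hx]
    simp [h] at this
  · obtain ⟨x₀, hx₀, hmin⟩ := (isCompact_sphere (0 : Fin n → ℝ) 1).exists_isMinOn h
      (continuous_seminorm N).continuousOn
    have hx₀' : x₀ ≠ 0 := by
      rintro rfl
      simp at hx₀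
    refine ⟨N x₀, lt_of_le_of_ne (apply_nonneg N _) fun h0 => hx₀' (hN _ h0.symm), fun x => ?_⟩
    rcases eq_or_ne x 0 with rfl | hx
    · simp
    have hmem : (‖x‖⁻¹ • x) ∈ Metric.sphere (0 : Fin n → ℝ) 1 := by
      simp [norm_smul, norm_ne_zero_iff.2 hx]
    have h1 : N x₀ ≤ N (‖x‖⁻¹ • x) := hmin hmem
    rw [map_smul_eq_mul, norm_inv, norm_norm] at h1
    have hpos : 0 < ‖x‖ := norm_pos_iff.2 hx
    calc N x₀ * ‖x‖ ≤ ‖x‖⁻¹ * N x * ‖x‖ := by gcongr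
      _ = N x := by field_simp

/-! ## Matrix measures -/

theorem IsNorm.bddAbove_mulVec (hN : IsNorm N) (A : Matrix (Fin n) (Fin n) ℝ) :
    BddAbove ((fun x => N (A.mulVec x)) '' {x | N x ≤ 1}) := by
  obtain ⟨m, hm, hmN⟩ := hN.exists_le
  have hcomp : IsCompact {x : Fin n → ℝ | N x ≤ 1} := by
    refine Metric.isCompact_of_isClosed_isBounded
      (isClosed_le (continuous_seminorm N) continuous_const) ?_
    refine (Metric.isBounded_closedBall (x := (0 : Fin n → ℝ)) (r := 1 / m)).subset fun x hx => ?_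
    rw [mem_closedBall_zero_iff, le_div_iff₀ hm, mul_comm]
    exact (hmN x).trans hx
  refine hcomp.bddAbove_image ((continuous_seminorm N).comp ?_).continuousOn
  exact Continuous.matrix_mulVec continuous_const continuous_id

theorem IsNorm.le_inducedNorm (hN : IsNorm N) (A : Matrix (Fin n) (Fin n) ℝ) (x : Fin n → ℝ) :
    N (A.mulVec x) ≤ inducedNorm N A * N x := by
  rcases eq_or_ne x 0 with rfl | hx
  · simp
  have hpos : 0 < N x := lt_of_le_of_ne (apply_nonneg N _) fun h0 => hx (hN _ h0.symm)
  have h1 : N (A.mulVec ((N x)⁻¹ • x)) ≤ inducedNorm N A := by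
    refine le_csSup (hN.bddAbove_mulVec A) ⟨_, ?_, rfl⟩
    change N ((N x)⁻¹ • x) ≤ 1
    rw [map_smul_eq_mul, Real.norm_of_nonneg (by positivity), inv_mul_cancel₀ hpos.ne']
  rw [Matrix.mulVec_smul, map_smul_eq_mul, Real.norm_of_nonneg (by positivity),
    inv_mul_le_iff₀ hpos] at h1
  linarith

theorem inducedNorm_le (N : Seminorm ℝ (Fin n → ℝ)) (A : Matrix (Fin n) (Fin n) ℝ) {M : ℝ}
    (h : ∀ x, N x ≤ 1 → N (A.mulVec x) ≤ M) : inducedNorm N A ≤ M := by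
  refine csSup_le ⟨_, 0, by simp, rfl⟩ ?_
  rintro _ ⟨x, hx, rfl⟩
  exact h x hx

/-- For `h ≤ k`, the matrix `1 + hA` is a convex combination of `1` and `1 + kA`. With a lower
bound, monotonicity makes the limit defining the matrix measure exist. -/
theorem IsNorm.monotoneOn_quotient (hN : IsNorm N) (A : Matrix (Fin n) (Fin n) ℝ) :
    MonotoneOn (fun h : ℝ => (inducedNorm N (1 + h • A) - 1) / h) (Ioi 0) := by
  intro h hh k hk hhk
  simp only [mem_Ioi] at hh hk
  have key : inducedNorm N (1 + h • A) ≤ (1 - h / k) + h / k * inducedNorm N (1 + k • A) := by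
    have h1 : h / k ≤ 1 := (div_le_one hk).2 hhk
    refine inducedNorm_le N _ fun x hx => ?_
    have e : (1 + h • A).mulVec x = (1 - h / k) • x + (h / k) • (1 + k • A).mulVec x := by
      simp only [Matrix.add_mulVec, Matrix.one_mulVec, Matrix.smul_mulVec, smul_add, smul_smul]
      rw [div_mul_cancel₀ _ hk.ne']
      module
    rw [e]
    refine (map_add_le_add N _ _).trans ?_
    rw [map_smul_eq_mul, map_smul_eq_mul, Real.norm_of_nonneg (by linarith),
      Real.norm_of_nonneg (by positivity)]
    refine add_le_add ?_ ?_
    · exact mul_le_of_le_one_right (by linarith) hx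
    · refine mul_le_mul_of_nonneg_left ?_ (by positivity)
      refine le_csSup (hN.bddAbove_mulVec _) ⟨x, hx, rfl⟩
  simp only
  rw [div_le_div_iff₀ hh hk]
  have := mul_le_mul_of_nonneg_right key hk.le
  have e : ((1 - h / k) + h / k * inducedNorm N (1 + k • A)) * k
      = k - h + h * inducedNorm N (1 + k • A) := by field_simp
  rw [e] at this
  linarith

/-- Since `ℓ z = N z`, testing `ℓ` on `(1 + hA) z` bounds every difference quotient below by `ℓ (A
z) / N z`. The bound passes to the limit, which is the infimum of the quotients. -/
theorem IsSupporting.apply_mulVec_le (hN : IsNorm N) {z : Fin n → ℝ}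
    {ℓ : (Fin n → ℝ) →ₗ[ℝ] ℝ} (hℓ : IsSupporting N z ℓ) (A : Matrix (Fin n) (Fin n) ℝ) :
    ℓ (A.mulVec z) ≤ matrixMeasure N A * N z := by
  rcases eq_or_ne z 0 with rfl | hz
  · simp
  have hpos : 0 < N z := lt_of_le_of_ne (apply_nonneg N _) fun h0 => hz (hN _ h0.symm)
  have hlow : ∀ h ∈ Ioi (0 : ℝ), ℓ (A.mulVec z) / N z ≤ (inducedNorm N (1 + h • A) - 1) / h := by
    intro h hh
    rw [mem_Ioi] at hh
    have h1 := (hℓ.1 ((1 + h • A).mulVec z)).trans (hN.le_inducedNorm _ _)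
    rw [Matrix.add_mulVec, Matrix.one_mulVec, Matrix.smul_mulVec, map_add, map_smul, hℓ.2,
      smul_eq_mul] at h1
    rw [div_le_div_iff₀ hpos hh]
    linarith
  have hlim := (hN.monotoneOn_quotient A).tendsto_nhdsGT
    ⟨ℓ (A.mulVec z) / N z, by rintro _ ⟨h, hh, rfl⟩; exact hlow h hh⟩
  have hle : ℓ (A.mulVec z) / N z ≤ matrixMeasure N A := by
    rw [matrixMeasure, hlim.limUnder_eq]
    refine le_csInf ⟨_, 1, by simp, rfl⟩ ?_
    rintro _ ⟨h, hh, rfl⟩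
    exact hlow h hh
  rwa [div_le_iff₀ hpos] at hle

/-! ## A local criterion for monotonicity and a mean value inequality -/

/-- A supremum argument on the set where `Ψ ≤ Ψ a`. No continuity is required, so downward jumps are
allowed; the comparison at `r` involves only the pairs `(r, s)`. -/
theorem le_of_eventually_antitone {Ψ : ℝ → ℝ} {a b : ℝ} (hab : a ≤ b)
    (h : ∀ r ∈ Icc a b, ∀ᶠ s in 𝓝[Icc a b] r, (r < s → Ψ s ≤ Ψ r) ∧ (s < r → Ψ r ≤ Ψ s)) :
    Ψ b ≤ Ψ a := by
  set S : Set ℝ := {r | r ∈ Icc a b ∧ Ψ r ≤ Ψ a} with hS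
  have haS : a ∈ S := ⟨⟨le_rfl, hab⟩, le_rfl⟩
  have hbdd : BddAbove S := ⟨b, fun r hr => hr.1.2⟩
  set c := sSup S with hc
  have hcI : c ∈ Icc a b := ⟨le_csSup hbdd haS, csSup_le ⟨a, haS⟩ fun r hr => hr.1.2⟩
  obtain ⟨ε, hε, hball⟩ := Metric.mem_nhdsWithin_iff.1 (h c hcI)
  have hcS : c ∈ S := by
    obtain ⟨s, hs, hcs⟩ := exists_lt_of_lt_csSup ⟨a, haS⟩ (show c - ε < sSup S by linarith)
    rcases (le_csSup hbdd hs).eq_or_lt with e | hlt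
    · exact (show s = c from e) ▸ hs
    · refine ⟨hcI, ((hball ⟨?_, hs.1⟩).2 hlt).trans hs.2⟩
      rw [Metric.mem_ball, Real.dist_eq, abs_lt]
      constructor <;> linarith
  rcases hcI.2.eq_or_lt with e | hlt
  · exact e ▸ hcS.2
  exfalso
  set s := min b (c + ε / 2)
  have hcs : c < s := lt_min hlt (by linarith)
  have hsI : s ∈ Icc a b := ⟨hcI.1.trans hcs.le, min_le_left _ _⟩
  have hs : s ∈ S := by
    refine ⟨hsI, ((hball ⟨?_, hsI⟩).1 hcs).trans hcS.2⟩
    have : s ≤ c + ε / 2 := min_le_right _ _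
    rw [Metric.mem_ball, Real.dist_eq, abs_lt]
    constructor <;> linarith
  exact absurd (le_csSup hbdd hs) (not_le.2 hcs)

theorem seminorm_sub_le_of_derivWithin_le {γ : ℝ → Fin n → ℝ} {M : ℝ}
    (hγ : DifferentiableOn ℝ γ (Icc 0 1))
    (hM : ∀ r ∈ Icc (0 : ℝ) 1, N (derivWithin γ (Icc 0 1) r) ≤ M) {r s : ℝ}
    (hr : r ∈ Icc (0 : ℝ) 1) (hs : s ∈ Icc (0 : ℝ) 1) : N (γ s - γ r) ≤ M * |s - r| := by
  obtain ⟨ℓ, hℓN, hℓ⟩ := exists_isSupporting N (γ s - γ r)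
  have hℓabs : ∀ w, |ℓ w| ≤ N w := fun w => abs_le.2
    ⟨by have := hℓN (-w); rw [map_neg, map_neg_eq_map] at this; linarith, hℓN w⟩
  have hderiv : ∀ t ∈ Icc (0 : ℝ) 1,
      HasDerivWithinAt (fun t => ℓ (γ t)) (ℓ (derivWithin γ (Icc 0 1) t)) (Icc 0 1) t :=
    fun t ht => (LinearMap.toContinuousLinearMap ℓ).hasFDerivAt.comp_hasDerivWithinAt t
      (hγ t ht).hasDerivWithinAt
  have := (convex_Icc (0 : ℝ) 1).norm_image_sub_le_of_norm_hasDerivWithin_le hderiv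
    (fun t ht => (hℓabs _).trans (hM t ht)) hr hs
  rw [← hℓ, map_sub]
  exact (le_abs_self _).trans this

end SwitchedControl

namespace SwitchedControl

/-! ## One-sided Lipschitz estimates across a switching manifold -/

variable {n : ℕ} {N : Seminorm ℝ (Fin n → ℝ)}

/-- A piecewise smooth vector field on a convex open set `V`, equal to `Fp` where `H > 0` and to
`Fm` where `H < 0`, that satisfies the infinitesimal contraction conditions in the norm `N`. The
direction `d` is transversal to the zero set of `H`. -/
structure IsPiecewiseContracting (N : Seminorm ℝ (Fin n → ℝ)) (c : ℝ) (V : Set (Fin n → ℝ))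
    (d : Fin n → ℝ) (Fp Fm : (Fin n → ℝ) → Fin n → ℝ) (H : (Fin n → ℝ) → ℝ) : Prop where
  isOpen : IsOpen V
  convex : Convex ℝ V
  diff_pos : ∀ p ∈ V, DifferentiableAt ℝ Fp p
  diff_neg : ∀ p ∈ V, DifferentiableAt ℝ Fm p
  diff_switch : ∀ p ∈ V, DifferentiableAt ℝ H p
  transversal : ∀ p ∈ V, H p = 0 → 0 < fderiv ℝ H p d
  pos : ∀ p ∈ V, 0 ≤ H p → ∀ z ℓ, IsSupporting N z ℓ → ℓ (fderiv ℝ Fp p z) ≤ -c * N z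
  neg : ∀ p ∈ V, H p ≤ 0 → ∀ z ℓ, IsSupporting N z ℓ → ℓ (fderiv ℝ Fm p z) ≤ -c * N z
  jump : ∀ p ∈ V, H p = 0 → ∀ z ℓ, IsSupporting N z ℓ → fderiv ℝ H p z * ℓ (Fp p - Fm p) ≤ 0

/-- If `H` does not increase in the direction `z` at its zeros, then starting at a zero and moving
in the direction `z` one cannot enter the region `H > 0`. -/
theorem eventually_nonpos_of_fderiv_nonpos {H : (Fin n → ℝ) → ℝ} {W : Set (Fin n → ℝ)}
    {p z d : Fin n → ℝ} (hW : W ∈ 𝓝 p) (hdiff : ∀ q ∈ W, DifferentiableAt ℝ H q)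
    (hd : ∀ q ∈ W, H q = 0 → 0 < fderiv ℝ H q d) (hz : ∀ q ∈ W, H q = 0 → fderiv ℝ H q z ≤ 0)
    (hp : H p = 0) : ∀ᶠ s in 𝓝[>] (0 : ℝ), H (p + s • z) ≤ 0 := by
  obtain ⟨ρ, hρ, hball⟩ := Metric.mem_nhds_iff.1 hW
  have hsmall : ∀ᶠ s in 𝓝[>] (0 : ℝ), s * ‖z‖ < ρ := by
    have : Tendsto (fun s : ℝ => s * ‖z‖) (𝓝 0) (𝓝 (0 * ‖z‖)) :=
      Continuous.tendsto (by fun_prop) 0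
    rw [zero_mul] at this
    exact (this.mono_left nhdsWithin_le_nhds).eventually (gt_mem_nhds hρ)
  filter_upwards [hsmall, self_mem_nhdsWithin] with s hs hs0
  rw [mem_Ioi] at hs0
  have hsW : p + s • z ∈ W := hball (by
    simpa [norm_smul, abs_of_pos hs0] using hs)
  -- Tilting the direction to `z - κ d` makes `H` strictly decreasing at each zero met, so the
  -- tilted path cannot cross into `H > 0`. The claim follows as `κ → 0`.
  have hlim : Tendsto (fun κ : ℝ => H (p + s • (z - κ • d))) (𝓝[>] 0) (𝓝 (H (p + s • z))) := by
    have h1 : Tendsto (fun κ : ℝ => p + s • (z - κ • d)) (𝓝[>] 0) (𝓝 (p + s • z)) := by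
      have : Tendsto (fun κ : ℝ => p + s • (z - κ • d)) (𝓝 0)
          (𝓝 (p + s • (z - (0 : ℝ) • d))) := Continuous.tendsto (by fun_prop) 0
      rw [zero_smul, sub_zero] at this
      exact this.mono_left nhdsWithin_le_nhds
    exact (hdiff _ hsW).continuousAt.tendsto.comp h1
  refine le_of_tendsto hlim ?_
  have hκ : ∀ᶠ κ in 𝓝[>] (0 : ℝ), s * (‖z‖ + κ * ‖d‖) < ρ := by
    have : Tendsto (fun κ : ℝ => s * (‖z‖ + κ * ‖d‖)) (𝓝 0) (𝓝 (s * (‖z‖ + 0 * ‖d‖))) :=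
      Continuous.tendsto (by fun_prop) 0
    rw [zero_mul, add_zero] at this
    exact (this.mono_left nhdsWithin_le_nhds).eventually (gt_mem_nhds hs)
  filter_upwards [hκ, self_mem_nhdsWithin] with κ hκ hκ0
  rw [mem_Ioi] at hκ0
  have hmem : ∀ r ∈ Icc (0 : ℝ) s, p + r • (z - κ • d) ∈ W := by
    intro r hr
    refine hball ?_
    rw [mem_ball_iff_norm, add_sub_cancel_left, norm_smul, Real.norm_of_nonneg hr.1]
    calc r * ‖z - κ • d‖ ≤ s * (‖z‖ + κ * ‖d‖) := by
          refine mul_le_mul hr.2 ?_ (norm_nonneg _) hs0.le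
          refine (norm_sub_le _ _).trans ?_
          rw [norm_smul, Real.norm_of_nonneg hκ0.le]
      _ < ρ := hκ
  have hderiv : ∀ r ∈ Icc (0 : ℝ) s, HasDerivAt (fun r : ℝ => H (p + r • (z - κ • d)))
      (fderiv ℝ H (p + r • (z - κ • d)) (z - κ • d)) r := by
    intro r hr
    refine (hdiff _ (hmem r hr)).hasFDerivAt.comp_hasDerivAt r ?_
    simpa using ((hasDerivAt_id r).smul_const (z - κ • d)).const_add p
  refine image_le_of_deriv_right_lt_deriv_boundary (B := fun _ => 0) (B' := fun _ => 0)
    (fun r hr => (hderiv r hr).continuousAt.continuousWithinAt)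
    (fun r hr => (hderiv r ⟨hr.1, hr.2.le⟩).hasDerivWithinAt) (by simp [hp])
    (fun r => hasDerivAt_const r 0) (fun r hr h0 => ?_) ⟨hs0.le, le_rfl⟩
  have hm := hmem r ⟨hr.1, hr.2.le⟩
  rw [map_sub, map_smul, smul_eq_mul]
  have h1 := hz _ hm h0
  have h2 := mul_pos hκ0 (hd _ hm h0)
  linarith

/-- Integration along a segment of a piecewise smooth function with favourable jumps. -/
theorem sub_le_of_piecewise {A ψ h A' ψ' : ℝ → ℝ} {b : ℝ}
    (hA : ∀ r ∈ Icc (0 : ℝ) 1, HasDerivAt A (A' r) r)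
    (hψ : ∀ r ∈ Icc (0 : ℝ) 1, HasDerivAt ψ (ψ' r) r)
    (hh : ∀ r ∈ Icc (0 : ℝ) 1, ContinuousAt h r)
    (hneg : ∀ r ∈ Icc (0 : ℝ) 1, h r ≤ 0 → A' r ≤ b)
    (hpos : ∀ r ∈ Icc (0 : ℝ) 1, 0 ≤ h r → A' r + ψ' r ≤ b)
    (hright : ∀ r ∈ Icc (0 : ℝ) 1, h r = 0 → 0 < ψ r → ∀ᶠ s in 𝓝[>] r, h s ≤ 0)
    (hleft : ∀ r ∈ Icc (0 : ℝ) 1, h r = 0 → ψ r < 0 → ∀ᶠ s in 𝓝[<] r, h s ≤ 0) :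
    (A 1 + if 0 < h 1 then ψ 1 else 0) - (A 0 + if 0 < h 0 then ψ 0 else 0) ≤ b := by
  have hslope : ∀ {f : ℝ → ℝ} {f' r : ℝ}, HasDerivAt f f' r → f' ≤ b → ∀ ε > 0,
      ∀ᶠ s in 𝓝 r, (r < s → f s - f r ≤ (b + ε) * (s - r)) ∧
        (s < r → f r - f s ≤ (b + ε) * (r - s)) := by
    intro f f' r hf hb ε hε
    have := (hasDerivAt_iff_isLittleO.1 hf).bound hε
    filter_upwards [this] with s hs
    rw [Real.norm_eq_abs, Real.norm_eq_abs, smul_eq_mul, abs_le] at hs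
    constructor
    · intro hrs
      rw [abs_of_pos (by linarith)] at hs
      nlinarith [hs.2]
    · intro hrs
      rw [abs_of_neg (by linarith)] at hs
      nlinarith [hs.1]
  refine le_of_forall_pos_le_add fun ε hε => ?_
  have := le_of_eventually_antitone
    (Ψ := fun r => (A r + if 0 < h r then ψ r else 0) - (b + ε) * r) zero_le_one ?_
  · linarith
  intro r hr
  refine Eventually.filter_mono nhdsWithin_le_nhds ?_
  rcases lt_trichotomy (h r) 0 with hr0 | hr0 | hr0
  · filter_upwards [(hh r hr).eventually (gt_mem_nhds hr0),
      hslope (hA r hr) (hneg r hr hr0.le) ε hε] with s hs hs'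
    rw [if_neg (by linarith), if_neg (by linarith)]
    constructor
    · intro h1
      have := hs'.1 h1
      linarith
    · intro h1
      have := hs'.2 h1
      linarith
  · have hright' : 0 < ψ r → ∀ᶠ s in 𝓝 r, r < s → h s ≤ 0 := fun h1 =>
      eventually_nhdsWithin_iff.1 (hright r hr hr0 h1)
    have hleft' : ψ r < 0 → ∀ᶠ s in 𝓝 r, s < r → h s ≤ 0 := fun h1 =>
      eventually_nhdsWithin_iff.1 (hleft r hr hr0 h1)
    have hP := hslope ((hA r hr).add (hψ r hr)) (hpos r hr hr0.ge) ε hε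
    have hM := hslope (hA r hr) (hneg r hr hr0.le) ε hε
    simp only [Pi.add_apply] at hP
    -- At a zero of `h` the function has the value `A r`. Comparing it with `A + ψ` at a nearby `s`
    -- costs the jump `ψ r`, whose sign must be favourable on whichever side `h` is positive.
    have hR : ∀ᶠ s in 𝓝 r, r < s → 0 < h s → ψ r ≤ 0 := by
      rcases lt_or_ge 0 (ψ r) with h1 | h1
      · filter_upwards [hright' h1] with s hs h2 h3
        linarith [hs h2]
      · exact Eventually.of_forall fun _ _ _ => h1
    have hL : ∀ᶠ s in 𝓝 r, s < r → 0 < h s → 0 ≤ ψ r := by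
      rcases lt_or_ge (ψ r) 0 with h1 | h1
      · filter_upwards [hleft' h1] with s hs h2 h3
        linarith [hs h2]
      · exact Eventually.of_forall fun _ _ _ => h1
    filter_upwards [hP, hM, hR, hL] with s hP hM hR hL
    rw [if_neg (not_lt.2 hr0.le)]
    constructor
    · intro h1
      split_ifs with h2
      · have := hP.1 h1
        have := hR h1 h2
        linarith
      · have := hM.1 h1
        linarith
    · intro h1
      split_ifs with h2
      · have := hP.2 h1
        have := hL h1 h2
        linarith
      · have := hM.2 h1
        linarith
  · filter_upwards [(hh r hr).eventually (lt_mem_nhds hr0),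
      hslope ((hA r hr).add (hψ r hr)) (hpos r hr hr0.le) ε hε] with s hs hs'
    simp only [Pi.add_apply] at hs'
    rw [if_pos hr0, if_pos hs]
    constructor
    · intro h1
      have := hs'.1 h1
      linarith
    · intro h1
      have := hs'.2 h1
      linarith

variable {c : ℝ} {V : Set (Fin n → ℝ)} {d : Fin n → ℝ} {Fp Fm : (Fin n → ℝ) → Fin n → ℝ}
  {H : (Fin n → ℝ) → ℝ}

/-- The functional `ℓ` supports the direction of the segment at all its points, so one `ℓ` serves
for both branches and for the jump. Where the jump `ℓ (Fp - Fm)` is positive, `H` cannot increase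
along the segment at its zeros, so `H > 0` is not entered forwards; where it is negative, it is not
entered backwards. -/
theorem IsPiecewiseContracting.apply_sub_le (hV : IsPiecewiseContracting N c V d Fp Fm H)
    {x y : Fin n → ℝ} (hx : x ∈ V) (hy : y ∈ V) {ℓ : (Fin n → ℝ) →ₗ[ℝ] ℝ}
    (hℓ : IsSupporting N (x - y) ℓ) :
    ℓ ((if 0 < H x then Fp x else Fm x) - (if 0 < H y then Fp y else Fm y))
      ≤ -c * N (x - y) := by
  set z := x - y with hz
  have hmem : ∀ r ∈ Icc (0 : ℝ) 1, y + r • z ∈ V := fun r hr =>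
    hV.convex.add_smul_sub_mem hy hx hr
  have hline : ∀ r : ℝ, HasDerivAt (fun r : ℝ => y + r • z) z r := fun r => by
    simpa using ((hasDerivAt_id r).smul_const z).const_add y
  have hcomp : ∀ {F : (Fin n → ℝ) → Fin n → ℝ}, ∀ r ∈ Icc (0 : ℝ) 1,
      DifferentiableAt ℝ F (y + r • z) →
      HasDerivAt (fun r : ℝ => ℓ (F (y + r • z))) (ℓ (fderiv ℝ F (y + r • z) z)) r :=
    fun r _ hF => (LinearMap.toContinuousLinearMap ℓ).hasFDerivAt.comp_hasDerivAt r
      (hF.hasFDerivAt.comp_hasDerivAt r (hline r))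
  have hcontℓ : Continuous ℓ := LinearMap.continuous_of_finiteDimensional ℓ
  have hcontJ : ∀ p ∈ V, ContinuousAt (fun q => ℓ (Fp q - Fm q)) p := fun p hp =>
    hcontℓ.continuousAt.comp
      ((hV.diff_pos p hp).continuousAt.sub (hV.diff_neg p hp).continuousAt)
  have key := sub_le_of_piecewise (b := -c * N z) (h := fun r => H (y + r • z))
    (A := fun r => ℓ (Fm (y + r • z))) (A' := fun r => ℓ (fderiv ℝ Fm (y + r • z) z))
    (ψ := fun r => ℓ (Fp (y + r • z)) - ℓ (Fm (y + r • z)))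
    (ψ' := fun r => ℓ (fderiv ℝ Fp (y + r • z) z) - ℓ (fderiv ℝ Fm (y + r • z) z))
    (fun r hr => hcomp r hr (hV.diff_neg _ (hmem r hr)))
    (fun r hr => (hcomp r hr (hV.diff_pos _ (hmem r hr))).sub
      (hcomp r hr (hV.diff_neg _ (hmem r hr))))
    (fun r hr => ContinuousAt.comp (f := fun r : ℝ => y + r • z)
      (hV.diff_switch _ (hmem r hr)).continuousAt (hline r).continuousAt)
    (fun r hr h => hV.neg _ (hmem r hr) h z ℓ hℓ)
    (fun r hr h => by
      have := hV.pos _ (hmem r hr) h z ℓ hℓ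
      linarith) ?_ ?_
  · simp only [one_smul, zero_smul, add_zero] at key
    rw [show y + z = x by rw [hz]; abel] at key
    rw [map_sub]
    have e : ∀ p, ℓ (if 0 < H p then Fp p else Fm p)
        = ℓ (Fm p) + if 0 < H p then ℓ (Fp p) - ℓ (Fm p) else 0 := by
      intro p
      split_ifs <;> ring
    rw [e, e]
    exact key
  · intro r hr h0 hψ
    have hp := hmem r hr
    have hW : {q | q ∈ V ∧ 0 < ℓ (Fp q - Fm q)} ∈ 𝓝 (y + r • z) := by
      refine inter_mem (hV.isOpen.mem_nhds hp) ((hcontJ _ hp).eventually (lt_mem_nhds ?_))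
      simpa only [map_sub] using hψ
    have := eventually_nonpos_of_fderiv_nonpos (z := z) (d := d) hW
      (fun q hq => hV.diff_switch q hq.1) (fun q hq => hV.transversal q hq.1)
      (fun q hq hq0 => nonpos_of_mul_nonpos_left (hV.jump q hq.1 hq0 z ℓ hℓ) hq.2) h0
    have hT : Tendsto (fun s : ℝ => s - r) (𝓝[>] r) (𝓝[>] 0) := by
      refine tendsto_nhdsWithin_iff.2 ⟨?_, ?_⟩
      · have : Tendsto (fun s : ℝ => s - r) (𝓝 r) (𝓝 (r - r)) := Continuous.tendsto (by fun_prop) r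
        rw [sub_self] at this
        exact this.mono_left nhdsWithin_le_nhds
      · filter_upwards [self_mem_nhdsWithin] with s hs
        exact mem_Ioi.2 (sub_pos.2 hs)
    filter_upwards [hT.eventually this] with s hs
    convert hs using 2
    module
  · intro r hr h0 hψ
    have hp := hmem r hr
    have hW : {q | q ∈ V ∧ ℓ (Fp q - Fm q) < 0} ∈ 𝓝 (y + r • z) := by
      refine inter_mem (hV.isOpen.mem_nhds hp) ((hcontJ _ hp).eventually (gt_mem_nhds ?_))
      simpa only [map_sub] using hψ
    have := eventually_nonpos_of_fderiv_nonpos (z := -z) (d := d) hW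
      (fun q hq => hV.diff_switch q hq.1) (fun q hq => hV.transversal q hq.1)
      (fun q hq hq0 => by
        have h1 := hV.jump q hq.1 hq0 z ℓ hℓ
        rw [map_neg, neg_nonpos]
        by_contra h2
        exact absurd h1 (not_le.2 (mul_pos_of_neg_of_neg (not_le.1 h2) hq.2))) h0
    have hT : Tendsto (fun s : ℝ => r - s) (𝓝[<] r) (𝓝[>] 0) := by
      refine tendsto_nhdsWithin_iff.2 ⟨?_, ?_⟩
      · have : Tendsto (fun s : ℝ => r - s) (𝓝 r) (𝓝 (r - r)) := Continuous.tendsto (by fun_prop) r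
        rw [sub_self] at this
        exact this.mono_left nhdsWithin_le_nhds
      · filter_upwards [self_mem_nhdsWithin] with s hs
        exact mem_Ioi.2 (sub_pos.2 hs)
    filter_upwards [hT.eventually this] with s hs
    convert hs using 2
    module

/-! ### Dissipativity of the set-valued field -/

/-- The convex combinations of the two branches that are admissible at `x`. -/
def admissibleValues (Fp Fm : (Fin n → ℝ) → Fin n → ℝ) (H : (Fin n → ℝ) → ℝ) (x : Fin n → ℝ) :
    Set (Fin n → ℝ) :=
  (fun α : ℝ => Fm x + α • (Fp x - Fm x)) ''
    {α | α ∈ Icc (0 : ℝ) 1 ∧ (0 < H x → α = 1) ∧ (H x < 0 → α = 0)}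

theorem eventually_pos_of_transversal {x : Fin n → ℝ} (hx : DifferentiableAt ℝ H x)
    (hd : H x = 0 → 0 < fderiv ℝ H x d) (h0 : 0 ≤ H x) {k : ℝ} (hk : 0 < k) :
    ∀ᶠ a in 𝓝[>] (0 : ℝ), 0 < H (x + (k * a) • d) := by
  have hderiv : HasDerivAt (fun a : ℝ => H (x + (k * a) • d)) (k * fderiv ℝ H x d) 0 := by
    have h1 : HasDerivAt (fun a : ℝ => x + (k * a) • d) (k • d) 0 := by
      simpa using (((hasDerivAt_id (0 : ℝ)).const_mul k).smul_const d).const_add x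
    have h2 : HasFDerivAt H (fderiv ℝ H x) (x + (k * 0) • d) := by
      simpa using hx.hasFDerivAt
    simpa only [map_smul, map_neg, smul_eq_mul] using! h2.comp_hasDerivAt (0 : ℝ) h1
  rcases h0.eq_or_lt with h | h
  · have hpos : 0 < k * fderiv ℝ H x d := mul_pos hk (hd h.symm)
    have h3 := (hasDerivAt_iff_isLittleO.1 hderiv).bound (half_pos hpos)
    filter_upwards [nhdsWithin_le_nhds h3, self_mem_nhdsWithin] with a ha ha0
    rw [mem_Ioi] at ha0
    simp only [mul_zero, zero_smul, add_zero, ← h, sub_zero, smul_eq_mul, Real.norm_eq_abs,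
      abs_of_pos ha0, abs_le] at ha
    nlinarith [ha.1]
  · refine nhdsWithin_le_nhds (hderiv.continuousAt.eventually (lt_mem_nhds ?_))
    simpa using h

theorem eventually_neg_of_transversal {x : Fin n → ℝ} (hx : DifferentiableAt ℝ H x)
    (hd : H x = 0 → 0 < fderiv ℝ H x d) (h0 : H x ≤ 0) {k : ℝ} (hk : 0 < k) :
    ∀ᶠ a in 𝓝[>] (0 : ℝ), H (x - (k * a) • d) < 0 := by
  have hderiv : HasDerivAt (fun a : ℝ => H (x - (k * a) • d)) (-(k * fderiv ℝ H x d)) 0 := by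
    have h1 : HasDerivAt (fun a : ℝ => x - (k * a) • d) (-(k • d)) 0 := by
      simpa using (((hasDerivAt_id (0 : ℝ)).const_mul k).smul_const d).const_sub x
    have h2 : HasFDerivAt H (fderiv ℝ H x) (x - (k * 0) • d) := by
      simpa using hx.hasFDerivAt
    simpa only [map_smul, map_neg, smul_eq_mul] using! h2.comp_hasDerivAt (0 : ℝ) h1
  rcases h0.eq_or_lt with h | h
  · have hpos : 0 < k * fderiv ℝ H x d := mul_pos hk (hd h)
    have h3 := (hasDerivAt_iff_isLittleO.1 hderiv).bound (half_pos hpos)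
    filter_upwards [nhdsWithin_le_nhds h3, self_mem_nhdsWithin] with a ha ha0
    rw [mem_Ioi] at ha0
    simp only [mul_zero, zero_smul, sub_zero, h, smul_eq_mul, Real.norm_eq_abs,
      abs_of_pos ha0, abs_le] at ha
    nlinarith [ha.2]
  · refine nhdsWithin_le_nhds (hderiv.continuousAt.eventually (gt_mem_nhds ?_))
    simpa using h

/-- The strong dissipativity inequality for the set-valued field. -/
theorem IsPiecewiseContracting.dissipative_aux (hV : IsPiecewiseContracting N c V d Fp Fm H)
    {x y : Fin n → ℝ} (hx : x ∈ V) (hy : y ∈ V) {α β : ℝ} (hα : α ∈ Icc (0 : ℝ) 1)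
    (hxp : 0 < H x → α = 1) (hxm : H x < 0 → α = 0) (hβ : β ∈ Icc (0 : ℝ) 1)
    (hyp : 0 < H y → β = 1) (hym : H y < 0 → β = 0) (hαβ : β ≤ α) {h : ℝ} (hh : 0 < h) :
    (1 + h * c) * N (x - y) ≤
      N (x - y - h • ((Fm x + α • (Fp x - Fm x)) - (Fm y + β • (Fp y - Fm y)))) := by
  -- The weights `β`, `α - β`, `1 - α` couple the two convex combinations, pairing `Fp` with `Fp`,
  -- `Fp` with `Fm` and `Fm` with `Fm`. The offsets push each point strictly into the region of its
  -- branch and are chosen so that all three pairs have the same difference `x - y + a d`; one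
  -- supporting functional then handles their sum.
  set v : ℝ → Fin n → ℝ := fun a =>
    β • (Fp (x + (2 * a) • d) - Fp (y + (1 * a) • d)) +
    (α - β) • (Fp (x + (1 / 2 * a) • d) - Fm (y - (1 / 2 * a) • d)) +
    (1 - α) • (Fm (x - (1 * a) • d) - Fm (y - (2 * a) • d)) with hv
  set z : ℝ → Fin n → ℝ := fun a => x - y + a • d with hz
  have hlin : ∀ (p : Fin n → ℝ) (k : ℝ), Continuous fun a : ℝ => p + (k * a) • d := by
    intro p k; fun_prop
  have hlin' : ∀ (p : Fin n → ℝ) (k : ℝ), Continuous fun a : ℝ => p - (k * a) • d := by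
    intro p k; fun_prop
  have hzc : ContinuousAt z 0 := by
    refine Continuous.continuousAt ?_
    fun_prop
  have hvc : ContinuousAt v 0 := by
    have hP : ∀ p ∈ V, ∀ k : ℝ, ContinuousAt (fun a : ℝ => Fp (p + (k * a) • d)) 0 :=
      fun p hp k => ContinuousAt.comp (f := fun a : ℝ => p + (k * a) • d)
        (by simpa using (hV.diff_pos p hp).continuousAt) (hlin p k).continuousAt
    have hM : ∀ p ∈ V, ∀ k : ℝ, ContinuousAt (fun a : ℝ => Fm (p - (k * a) • d)) 0 :=
      fun p hp k => ContinuousAt.comp (f := fun a : ℝ => p - (k * a) • d)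
        (by simpa using (hV.diff_neg p hp).continuousAt) (hlin' p k).continuousAt
    exact ((((hP x hx 2).sub (hP y hy 1)).const_smul β).add
      (((hP x hx _).sub (hM y hy _)).const_smul (α - β))).add
      (((hM x hx 1).sub (hM y hy 2)).const_smul (1 - α))
  have hlim1 : Tendsto (fun a => (1 + h * c) * N (z a)) (𝓝[>] 0) (𝓝 ((1 + h * c) * N (z 0))) :=
    (((continuous_seminorm N).continuousAt.comp hzc).tendsto.const_mul _).mono_left
      nhdsWithin_le_nhds
  have hlim2 : Tendsto (fun a => N (z a - h • v a)) (𝓝[>] 0) (𝓝 (N (z 0 - h • v 0))) :=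
    ((continuous_seminorm N).continuousAt.comp
      (hzc.sub (hvc.const_smul h))).tendsto.mono_left nhdsWithin_le_nhds
  have hmemV : ∀ p ∈ V, ∀ k : ℝ, ∀ᶠ a in 𝓝[>] (0 : ℝ), p + (k * a) • d ∈ V := fun p hp k =>
    nhdsWithin_le_nhds ((hlin p k).continuousAt.eventually
      (hV.isOpen.mem_nhds (by simpa using hp)))
  have hmemV' : ∀ p ∈ V, ∀ k : ℝ, ∀ᶠ a in 𝓝[>] (0 : ℝ), p - (k * a) • d ∈ V := fun p hp k =>
    nhdsWithin_le_nhds ((hlin' p k).continuousAt.eventually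
      (hV.isOpen.mem_nhds (by simpa using hp)))
  have hterm : ∀ {X Y u w : ℝ → Fin n → ℝ} {t : ℝ}, 0 ≤ t →
      (t ≠ 0 → ∀ᶠ a in 𝓝[>] (0 : ℝ), X a ∈ V ∧ Y a ∈ V ∧ X a - Y a = z a ∧
        (if 0 < H (X a) then Fp (X a) else Fm (X a)) = u a ∧
        (if 0 < H (Y a) then Fp (Y a) else Fm (Y a)) = w a) →
      ∀ᶠ a in 𝓝[>] (0 : ℝ), ∀ ℓ, IsSupporting N (z a) ℓ →
        t * ℓ (u a - w a) ≤ t * (-c * N (z a)) := by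
    intro X Y u w t ht hyp
    rcases eq_or_ne t 0 with rfl | h0
    · exact Eventually.of_forall fun a ℓ _ => by simp
    · filter_upwards [hyp h0] with a ha ℓ hℓ
      obtain ⟨hX, hY, hXY, hu, hw⟩ := ha
      refine mul_le_mul_of_nonneg_left ?_ ht
      rw [← hXY] at hℓ ⊢
      rw [← hu, ← hw]
      exact hV.apply_sub_le hX hY hℓ
  -- A branch used with nonzero weight lies on the right side of the manifold, or on it; pairs of
  -- weight zero need no sign condition.
  have hx0 : α ≠ 0 → 0 ≤ H x := fun h1 => not_lt.1 fun h2 => h1 (hxm h2)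
  have hx1 : α ≠ 1 → H x ≤ 0 := fun h1 => not_lt.1 fun h2 => h1 (hxp h2)
  have hy0 : β ≠ 0 → 0 ≤ H y := fun h1 => not_lt.1 fun h2 => h1 (hym h2)
  have hy1 : β ≠ 1 → H y ≤ 0 := fun h1 => not_lt.1 fun h2 => h1 (hyp h2)
  have t1 := hterm (X := fun a => x + (2 * a) • d) (Y := fun a => y + (1 * a) • d)
    (u := fun a => Fp (x + (2 * a) • d)) (w := fun a => Fp (y + (1 * a) • d)) hβ.1 (by
      intro h0
      have hα0 : α ≠ 0 := fun h1 => h0 (le_antisymm (h1 ▸ hαβ) hβ.1)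
      filter_upwards [hmemV x hx 2, hmemV y hy 1, eventually_pos_of_transversal (hV.diff_switch _ hx)
          (hV.transversal _ hx) (hx0 hα0) two_pos,
        eventually_pos_of_transversal (hV.diff_switch _ hy)
          (hV.transversal _ hy) (hy0 h0) one_pos] with a h1 h2 h3 h4
      refine ⟨h1, h2, ?_, if_pos h3, if_pos h4⟩
      simp only [hz]
      module)
  have t2 := hterm (X := fun a => x + (1 / 2 * a) • d) (Y := fun a => y - (1 / 2 * a) • d)
    (u := fun a => Fp (x + (1 / 2 * a) • d)) (w := fun a => Fm (y - (1 / 2 * a) • d))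
    (sub_nonneg.2 hαβ) (by
      intro h0
      have hlt : β < α := lt_of_le_of_ne hαβ fun h1 => h0 (by rw [h1, sub_self])
      filter_upwards [hmemV x hx (1 / 2), hmemV' y hy (1 / 2),
        eventually_pos_of_transversal (hV.diff_switch _ hx)
          (hV.transversal _ hx) (hx0 (hβ.1.trans_lt hlt).ne') one_half_pos,
        eventually_neg_of_transversal (hV.diff_switch _ hy)
          (hV.transversal _ hy) (hy1 (hlt.trans_le hα.2).ne) one_half_pos] with a h1 h2 h3 h4
      refine ⟨h1, h2, ?_, if_pos h3, if_neg h4.le.not_gt⟩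
      simp only [hz]
      module)
  have t3 := hterm (X := fun a => x - (1 * a) • d) (Y := fun a => y - (2 * a) • d)
    (u := fun a => Fm (x - (1 * a) • d)) (w := fun a => Fm (y - (2 * a) • d))
    (sub_nonneg.2 hα.2) (by
      intro h0
      have hlt : α < 1 := lt_of_le_of_ne hα.2 fun h1 => h0 (by rw [h1, sub_self])
      filter_upwards [hmemV' x hx 1, hmemV' y hy 2, eventually_neg_of_transversal (hV.diff_switch _ hx)
          (hV.transversal _ hx) (hx1 hlt.ne) one_pos,
        eventually_neg_of_transversal (hV.diff_switch _ hy)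
          (hV.transversal _ hy) (hy1 (hαβ.trans_lt hlt).ne) two_pos] with a h1 h2 h3 h4
      refine ⟨h1, h2, ?_, if_neg h3.le.not_gt, if_neg h4.le.not_gt⟩
      simp only [hz]
      module)
  have hle := le_of_tendsto_of_tendsto hlim1 hlim2 (by
    filter_upwards [t1, t2, t3] with a h1 h2 h3
    obtain ⟨ℓ, hℓ⟩ := exists_isSupporting N (z a)
    have h4 := hℓ.1 (z a - h • v a)
    have h5 : ℓ (v a) ≤ -c * N (z a) := by
      simp only [hv, map_add, map_smul, smul_eq_mul]
      have := h1 ℓ hℓ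
      have := h2 ℓ hℓ
      have := h3 ℓ hℓ
      linarith
    rw [map_sub, map_smul, smul_eq_mul, hℓ.2] at h4
    have := mul_le_mul_of_nonneg_left h5 hh.le
    linarith)
  have ez : z 0 = x - y := by simp [hz]
  have ev : v 0 = (Fm x + α • (Fp x - Fm x)) - (Fm y + β • (Fp y - Fm y)) := by
    simp only [hv, mul_zero, zero_smul, add_zero, sub_zero]
    module
  rwa [ez, ev] at hle

/-- The case `α < β` reduces to `β ≤ α` by exchanging the two points, since `N` is even. -/
theorem IsPiecewiseContracting.dissipative (hV : IsPiecewiseContracting N c V d Fp Fm H)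
    {x y v w : Fin n → ℝ} (hx : x ∈ V) (hy : y ∈ V) (hv : v ∈ admissibleValues Fp Fm H x)
    (hw : w ∈ admissibleValues Fp Fm H y) {h : ℝ} (hh : 0 < h) :
    (1 + h * c) * N (x - y) ≤ N (x - y - h • (v - w)) := by
  obtain ⟨α, ⟨hα, hxp, hxm⟩, rfl⟩ := hv
  obtain ⟨β, ⟨hβ, hyp, hym⟩, rfl⟩ := hw
  rcases le_total β α with hαβ | hαβ
  · exact hV.dissipative_aux hx hy hα hxp hxm hβ hyp hym hαβ hh
  · have := hV.dissipative_aux hy hx hβ hyp hym hα hxp hxm hαβ hh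
    rw [map_sub_rev N y x] at this
    refine this.trans_eq ?_
    rw [← map_neg_eq_map N]
    congr 1
    module

end SwitchedControl

namespace SwitchedControl

/-! ## The closed loop is locally piecewise contracting -/

variable {n m : ℕ} {N : Seminorm ℝ (Fin n → ℝ)}

theorem jacobian_mulVec (F : (Fin n → ℝ) → Fin n → ℝ) (x z : Fin n → ℝ) :
    (jacobian F x).mulVec z = fderiv ℝ F x z :=
  LinearMap.toMatrix'_mulVec _ _

theorem grad_dotProduct (H : (Fin n → ℝ) → ℝ) (x z : Fin n → ℝ) :
    grad H x ⬝ᵥ z = fderiv ℝ H x z := by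
  conv_rhs => rw [pi_eq_sum_univ' z, map_sum]
  simp [grad, dotProduct, mul_comm]

theorem contDiffOn_mulVec {U : Set (Fin n → ℝ)} {g : (Fin n → ℝ) → Matrix (Fin n) (Fin m) ℝ}
    (hg : ∀ i j, ContDiffOn ℝ 1 (fun x => g x i j) U) {u : (Fin n → ℝ) → Fin m → ℝ}
    (hu : ContDiffOn ℝ 1 u U) : ContDiffOn ℝ 1 (fun x => (g x).mulVec (u x)) U := by
  refine contDiffOn_pi.2 fun i => ?_
  simp only [Matrix.mulVec, dotProduct]
  exact ContDiffOn.sum fun j _ => (hg i j).mul (contDiffOn_pi.1 hu j)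

theorem exists_transversal {H : (Fin n → ℝ) → ℝ} {x : Fin n → ℝ} (h : grad H x ≠ 0) :
    ∃ d, 0 < fderiv ℝ H x d := by
  obtain ⟨j, hj⟩ := Function.ne_iff.1 h
  have hj' : fderiv ℝ H x (Pi.single j 1) ≠ 0 := hj
  rcases hj'.lt_or_gt with h1 | h1
  · exact ⟨-Pi.single j 1, by rw [map_neg]; linarith⟩
  · exact ⟨_, h1⟩

variable {U : Set (Fin n → ℝ)} {H : (Fin n → ℝ) → ℝ}

/-- A regular zero of `H` is approached from the positive region along a transversal direction, so
the measure bound is available on all of `0 ≤ H`. -/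
theorem mem_closure_regionPos (hU : IsOpen U) (hH : ContDiffOn ℝ 1 H U)
    (hreg : ∀ x ∈ switchingManifold U H, grad H x ≠ 0) {x : Fin n → ℝ} (hx : x ∈ U)
    (h0 : 0 ≤ H x) : x ∈ closure (regionPos U H) := by
  rcases h0.eq_or_lt with h | h
  · obtain ⟨d, hd⟩ := exists_transversal (hreg x ⟨hx, h.symm⟩)
    have hdiff := (hH.contDiffAt (hU.mem_nhds hx)).differentiableAt one_ne_zero
    have h1 := eventually_pos_of_transversal hdiff (fun _ => hd) h0 one_pos
    have hlim : Tendsto (fun a : ℝ => x + (1 * a) • d) (𝓝[>] 0) (𝓝 x) := by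
      have : Tendsto (fun a : ℝ => x + (1 * a) • d) (𝓝 0) (𝓝 (x + (1 * (0 : ℝ)) • d)) :=
        Continuous.tendsto (by fun_prop) 0
      rw [mul_zero, zero_smul, add_zero] at this
      exact this.mono_left nhdsWithin_le_nhds
    refine mem_closure_of_tendsto hlim ?_
    filter_upwards [h1, hlim.eventually (hU.mem_nhds hx)] with a h2 h3
    exact ⟨h3, h2⟩
  · exact subset_closure ⟨hx, h⟩

theorem mem_closure_regionNeg (hU : IsOpen U) (hH : ContDiffOn ℝ 1 H U)
    (hreg : ∀ x ∈ switchingManifold U H, grad H x ≠ 0) {x : Fin n → ℝ} (hx : x ∈ U)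
    (h0 : H x ≤ 0) : x ∈ closure (regionNeg U H) := by
  rcases h0.eq_or_lt with h | h
  · obtain ⟨d, hd⟩ := exists_transversal (hreg x ⟨hx, h⟩)
    have hdiff := (hH.contDiffAt (hU.mem_nhds hx)).differentiableAt one_ne_zero
    have h1 := eventually_neg_of_transversal hdiff (fun _ => hd) h0 one_pos
    have hlim : Tendsto (fun a : ℝ => x - (1 * a) • d) (𝓝[>] 0) (𝓝 x) := by
      have : Tendsto (fun a : ℝ => x - (1 * a) • d) (𝓝 0) (𝓝 (x - (1 * (0 : ℝ)) • d)) :=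
        Continuous.tendsto (by fun_prop) 0
      rw [mul_zero, zero_smul, sub_zero] at this
      exact this.mono_left nhdsWithin_le_nhds
    refine mem_closure_of_tendsto hlim ?_
    filter_upwards [h1, hlim.eventually (hU.mem_nhds hx)] with a h2 h3
    exact ⟨h3, h2⟩
  · exact subset_closure ⟨hx, h⟩

theorem exists_isPiecewiseContracting (hU : IsOpen U)
    {f : (Fin n → ℝ) → Fin n → ℝ} (hf : ContDiffOn ℝ 1 f U)
    {g : (Fin n → ℝ) → Matrix (Fin n) (Fin m) ℝ}
    (hg : ∀ i j, ContDiffOn ℝ 1 (fun x => g x i j) U)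
    {uPos uNeg : (Fin n → ℝ) → Fin m → ℝ}
    (huPos : ContDiffOn ℝ 1 uPos U) (huNeg : ContDiffOn ℝ 1 uNeg U)
    (hH : ContDiffOn ℝ 1 H U)
    (hreg : ∀ x ∈ switchingManifold U H, grad H x ≠ 0)
    (hN : IsNorm N) {c₁ c₂ : ℝ}
    (hpos : ∀ x ∈ closure (regionPos U H) ∩ U,
      matrixMeasure N (jacobian f x + jacobian (fun y => (g y).mulVec (uPos y)) x) ≤ -c₁)
    (hneg : ∀ x ∈ closure (regionNeg U H) ∩ U,
      matrixMeasure N (jacobian f x + jacobian (fun y => (g y).mulVec (uNeg y)) x) ≤ -c₂)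
    (hjump : ∀ x ∈ switchingManifold U H,
      matrixMeasure N (Matrix.vecMulVec ((g x).mulVec (uPos x - uNeg x)) (grad H x)) = 0)
    {p : Fin n → ℝ} (hp : p ∈ U) :
    ∃ V d, p ∈ V ∧ V ⊆ U ∧ IsPiecewiseContracting N (min c₁ c₂) V d
      (fun x => f x + (g x).mulVec (uPos x)) (fun x => f x + (g x).mulVec (uNeg x)) H := by
  have hd : ∀ {F : (Fin n → ℝ) → Fin n → ℝ}, ContDiffOn ℝ 1 F U → ∀ q ∈ U,
      DifferentiableAt ℝ F q := fun hF q hq =>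
    (hF.contDiffAt (hU.mem_nhds hq)).differentiableAt one_ne_zero
  have hHd : ∀ q ∈ U, DifferentiableAt ℝ H q := fun q hq =>
    (hH.contDiffAt (hU.mem_nhds hq)).differentiableAt one_ne_zero
  have hgp := contDiffOn_mulVec hg huPos
  have hgm := contDiffOn_mulVec hg huNeg
  have bound : ∀ {u : (Fin n → ℝ) → Fin m → ℝ} {c : ℝ} {q : Fin n → ℝ}, q ∈ U →
      ContDiffOn ℝ 1 (fun x => (g x).mulVec (u x)) U → min c₁ c₂ ≤ c →
      matrixMeasure N (jacobian f q + jacobian (fun y => (g y).mulVec (u y)) q) ≤ -c →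
      ∀ z ℓ, IsSupporting N z ℓ →
        ℓ (fderiv ℝ (fun x => f x + (g x).mulVec (u x)) q z) ≤ -(min c₁ c₂) * N z := by
    intro u c q hq hu hc hμ z ℓ hℓ
    have h1 := hℓ.apply_mulVec_le hN
      (jacobian f q + jacobian (fun y => (g y).mulVec (u y)) q)
    rw [Matrix.add_mulVec, jacobian_mulVec, jacobian_mulVec] at h1
    rw [fderiv_fun_add (hd hf q hq) (hd hu q hq)]
    refine h1.trans (mul_le_mul_of_nonneg_right ?_ (apply_nonneg N z))
    linarith
  have hloc : ∃ V d, p ∈ V ∧ V ⊆ U ∧ IsOpen V ∧ Convex ℝ V ∧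
      ∀ q ∈ V, H q = 0 → 0 < fderiv ℝ H q d := by
    rcases eq_or_ne (H p) 0 with h0 | h0
    · obtain ⟨d, hd⟩ := exists_transversal (hreg p ⟨hp, h0⟩)
      have hcont : ContinuousAt (fun q => fderiv ℝ H q d) p :=
        ((hH.continuousOn_fderiv_of_isOpen hU le_rfl).continuousAt (hU.mem_nhds hp)).clm_apply
          continuousAt_const
      obtain ⟨ε, hε, hball⟩ := Metric.mem_nhds_iff.1
        (inter_mem (hU.mem_nhds hp) (hcont.eventually (lt_mem_nhds hd)))
      exact ⟨Metric.ball p ε, d, Metric.mem_ball_self hε, fun q hq => (hball hq).1,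
        Metric.isOpen_ball, convex_ball p ε, fun q hq _ => (hball hq).2⟩
    -- Off the manifold a small ball contains no zero of `H`; transversality is vacuous and `d = 0`
    -- will do.
    · obtain ⟨ε, hε, hball⟩ := Metric.mem_nhds_iff.1
        (inter_mem (hU.mem_nhds hp) ((hHd p hp).continuousAt.eventually_ne h0))
      exact ⟨Metric.ball p ε, 0, Metric.mem_ball_self hε, fun q hq => (hball hq).1,
        Metric.isOpen_ball, convex_ball p ε, fun q hq h1 => absurd h1 (hball hq).2⟩
  obtain ⟨V, d, hpV, hVU, hVo, hVc, htr⟩ := hloc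
  refine ⟨V, d, hpV, hVU, hVo, hVc, fun q hq => (hd hf q (hVU hq)).add (hd hgp q (hVU hq)),
    fun q hq => (hd hf q (hVU hq)).add (hd hgm q (hVU hq)), fun q hq => hHd q (hVU hq), htr,
    fun q hq h0 => bound (hVU hq) hgp (min_le_left _ _)
      (hpos q ⟨mem_closure_regionPos hU hH hreg (hVU hq) h0, hVU hq⟩),
    fun q hq h0 => bound (hVU hq) hgm (min_le_right _ _)
      (hneg q ⟨mem_closure_regionNeg hU hH hreg (hVU hq) h0, hVU hq⟩), ?_⟩
  -- The rank-one matrix sends `z` to `(∇H z)` times the jump of the field, so its zero measure is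
  -- exactly what bounds the product.
  intro q hq h0 z ℓ hℓ
  have h1 := hℓ.apply_mulVec_le hN
    (Matrix.vecMulVec ((g q).mulVec (uPos q - uNeg q)) (grad H q))
  rw [hjump q ⟨hVU hq, h0⟩, zero_mul, Matrix.vecMulVec_mulVec, op_smul_eq_smul, grad_dotProduct,
    map_smul, smul_eq_mul, Matrix.mulVec_sub] at h1
  rwa [add_sub_add_left_eq_sub]

/-! ### Filippov sets and admissible values -/

theorem eq_of_mapClusterPt_of_eventuallyEq {X Y : Type*} [TopologicalSpace Y] [T2Space Y]
    {l : Filter X} {F G : X → Y} {v a : Y} (h : MapClusterPt v l F) (hFG : F =ᶠ[l] G)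
    (hG : Tendsto G l (𝓝 a)) : v = a := by
  have h1 : NeBot (𝓝 v ⊓ map F l) := h
  have h2 : NeBot (𝓝 v ⊓ 𝓝 a) :=
    h1.mono (inf_le_inf_left _ ((map_congr hFG).le.trans hG))
  exact eq_of_nhds_neBot h2

theorem convex_admissibleValues (Fp Fm : (Fin n → ℝ) → Fin n → ℝ) (H : (Fin n → ℝ) → ℝ)
    (x : Fin n → ℝ) : Convex ℝ (admissibleValues Fp Fm H x) := by
  rintro _ ⟨α, ⟨hα, hα1, hα0⟩, rfl⟩ _ ⟨β, ⟨hβ, hβ1, hβ0⟩, rfl⟩ s t hs ht hst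
  refine ⟨s * α + t * β, ⟨convex_Icc 0 1 hα hβ hs ht hst, fun h => ?_, fun h => ?_⟩, ?_⟩
  · rw [hα1 h, hβ1 h]
    linarith
  · rw [hα0 h, hβ0 h]
    ring
  · obtain rfl : t = 1 - s := by linarith
    simp only
    module

theorem isClosed_admissibleValues (Fp Fm : (Fin n → ℝ) → Fin n → ℝ) (H : (Fin n → ℝ) → ℝ)
    (x : Fin n → ℝ) : IsClosed (admissibleValues Fp Fm H x) := by
  refine IsCompact.isClosed (IsCompact.image ?_ (by fun_prop))
  refine isCompact_Icc.inter_right (IsClosed.inter ?_ ?_)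
  · exact isClosed_imp isOpen_const (isClosed_eq continuous_id continuous_const)
  · exact isClosed_imp isOpen_const (isClosed_eq continuous_id continuous_const)

theorem filippovMap_subset_admissibleValues {f : (Fin n → ℝ) → Fin n → ℝ}
    {g : (Fin n → ℝ) → Matrix (Fin n) (Fin m) ℝ} {uPos uNeg : (Fin n → ℝ) → Fin m → ℝ}
    {x : Fin n → ℝ}
    (hFp : ContinuousAt (fun x => f x + (g x).mulVec (uPos x)) x)
    (hFm : ContinuousAt (fun x => f x + (g x).mulVec (uNeg x)) x) (hHx : ContinuousAt H x) :
    filippovMap (regionPos U H ∪ regionNeg U H) (closedLoop f g (switchingControl H uPos uNeg)) x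
      ⊆ admissibleValues (fun x => f x + (g x).mulVec (uPos x))
          (fun x => f x + (g x).mulVec (uNeg x)) H x := by
  refine closedConvexHull_min ?_ (convex_admissibleValues _ _ _ _) (isClosed_admissibleValues _ _ _ _)
  intro v hv
  rw [mem_ofPred_eq, nhdsWithin_union, mapClusterPt_def, Filter.map_sup, clusterPt_sup] at hv
  rcases hv with hv | hv
  · have e := eq_of_mapClusterPt_of_eventuallyEq hv
      (G := fun x => f x + (g x).mulVec (uPos x)) (by
        filter_upwards [self_mem_nhdsWithin] with y hy
        simp only [closedLoop, switchingControl, if_pos hy.2]) (hFp.mono_left nhdsWithin_le_nhds)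
    -- A limit value from the positive region exists only if `x` is in its closure, which forces `0
    -- ≤ H x`.
    have hne : NeBot (𝓝[regionPos U H] x) := map_neBot_iff _ |>.1 (hv.neBot.mono inf_le_right)
    have h0 : 0 ≤ H x := ge_of_tendsto
      (hHx.mono_left (nhdsWithin_le_nhds (s := regionPos U H))) (by
      filter_upwards [self_mem_nhdsWithin] with y hy
      exact hy.2.le)
    refine ⟨1, ⟨⟨zero_le_one, le_rfl⟩, fun _ => rfl, fun h => absurd h (not_lt.2 h0)⟩, ?_⟩
    rw [e]
    simp
  · have e := eq_of_mapClusterPt_of_eventuallyEq hv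
      (G := fun x => f x + (g x).mulVec (uNeg x)) (by
        filter_upwards [self_mem_nhdsWithin] with y hy
        simp only [closedLoop, switchingControl, if_neg hy.2.not_gt, if_pos hy.2])
        (hFm.mono_left nhdsWithin_le_nhds)
    have hne : NeBot (𝓝[regionNeg U H] x) := map_neBot_iff _ |>.1 (hv.neBot.mono inf_le_right)
    have h0 : H x ≤ 0 := le_of_tendsto
      (hHx.mono_left (nhdsWithin_le_nhds (s := regionNeg U H))) (by
      filter_upwards [self_mem_nhdsWithin] with y hy
      exact hy.2.le)
    refine ⟨0, ⟨⟨le_rfl, zero_le_one⟩, fun h => absurd h (not_lt.2 h0), fun _ => rfl⟩, ?_⟩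
    rw [e]
    simp

end SwitchedControl

namespace SwitchedControl

/-! ## Contraction of Filippov solutions -/

variable {n : ℕ} {N : Seminorm ℝ (Fin n → ℝ)} {U D : Set (Fin n → ℝ)}
  {F : (Fin n → ℝ) → Fin n → ℝ} {c : ℝ}

theorem _root_.AbsolutelyContinuousOnInterval.seminorm_comp {Z : ℝ → Fin n → ℝ} {a b : ℝ}
    (hZ : AbsolutelyContinuousOnInterval Z a b) (N : Seminorm ℝ (Fin n → ℝ)) :
    AbsolutelyContinuousOnInterval (fun t => N (Z t)) a b := by
  obtain ⟨M, hM, hN⟩ := exists_seminorm_le N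
  have hlim : Tendsto (fun E : ℕ × (ℕ → ℝ × ℝ) =>
      M * ∑ i ∈ Finset.range E.1, dist (Z (E.2 i).1) (Z (E.2 i).2))
      (AbsolutelyContinuousOnInterval.totalLengthFilter ⊓
        𝓟 (AbsolutelyContinuousOnInterval.disjWithin a b)) (𝓝 (M * 0)) :=
    Filter.Tendsto.const_mul M hZ
  rw [mul_zero] at hlim
  refine squeeze_zero (fun E => Finset.sum_nonneg fun i _ => dist_nonneg) (fun E => ?_) hlim
  rw [Finset.mul_sum]
  refine Finset.sum_le_sum fun i _ => ?_
  rw [Real.dist_eq, dist_eq_norm]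
  exact (abs_seminorm_sub_le N _ _).trans (hN _)

/-- Two points satisfy the dissipativity inequality for all pairs of Filippov velocities. -/
def IsDissipativePair (N : Seminorm ℝ (Fin n → ℝ)) (c : ℝ) (D : Set (Fin n → ℝ))
    (F : (Fin n → ℝ) → Fin n → ℝ) (x y : Fin n → ℝ) : Prop :=
  ∀ v ∈ filippovMap D F x, ∀ w ∈ filippovMap D F y, ∀ h : ℝ, 0 < h →
    (1 + h * c) * N (x - y) ≤ N (x - y - h • (v - w))

/-- A backward step: with `h = t - s`, the point `Z t - h z'` is `Z s` up to `o(h)`, so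
dissipativity compares `N (Z t)` with the earlier value `N (Z s)`. -/
theorem deriv_seminorm_le {Z : ℝ → Fin n → ℝ} {z' : Fin n → ℝ} {t ψ' : ℝ}
    (hZ : HasDerivAt Z z' t) (hψ : HasDerivAt (fun s => N (Z s)) ψ' t)
    (hdiss : ∀ h : ℝ, 0 < h → (1 + h * c) * N (Z t) ≤ N (Z t - h • z')) :
    ψ' ≤ -c * N (Z t) := by
  obtain ⟨M, hM, hN⟩ := exists_seminorm_le N
  have key : ∀ ε > 0, ψ' ≤ -c * N (Z t) + (1 + M) * ε := by
    intro ε hε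
    have h1 := (hasDerivAt_iff_isLittleO.1 hZ).bound hε
    have h2 := (hasDerivAt_iff_isLittleO.1 hψ).bound hε
    obtain ⟨s, hs, hst⟩ := (((h1.and h2).filter_mono nhdsWithin_le_nhds).and
      (self_mem_nhdsWithin (s := Iio t))).exists
    obtain ⟨h1, h2⟩ := hs
    have hpos : 0 < t - s := sub_pos.2 hst
    have habs : ‖s - t‖ = t - s := by rw [Real.norm_eq_abs, abs_of_neg (by linarith)]; ring
    rw [habs] at h1 h2
    rw [Real.norm_eq_abs, smul_eq_mul, abs_le] at h2
    have h3 := hdiss (t - s) hpos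
    have h4 : N (Z t - (t - s) • z') ≤ N (Z s) + M * (ε * (t - s)) := by
      have e : Z t - (t - s) • z' = Z s - (Z s - Z t - (s - t) • z') := by module
      rw [e]
      refine (map_sub_le_add N _ _).trans (add_le_add le_rfl ?_)
      exact (hN _).trans (mul_le_mul_of_nonneg_left h1 hM.le)
    have h5 : (t - s) * ψ' ≤ (t - s) * (-c * N (Z t) + (1 + M) * ε) := by
      linarith [h2.2]
    exact le_of_mul_le_mul_left h5 hpos
  refine le_of_forall_pos_le_add fun ε hε => ?_
  have := key (ε / (1 + M)) (by positivity)
  rwa [mul_div_cancel₀ _ (by positivity)] at this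

/-- The function `exp (c t) N (X t - Y t)` is absolutely continuous with nonpositive derivative
almost everywhere. The endpoint `T` is a null set, so the pair need not be known to be dissipative
there; the first-exit argument in `exists_tube` relies on this. -/
theorem IsFilippovSolution.exp_mul_le {t₀ T : ℝ} {X Y : ℝ → Fin n → ℝ}
    (hX : IsFilippovSolution U D F t₀ X) (hY : IsFilippovSolution U D F t₀ Y) (hT : t₀ ≤ T)
    (hgood : ∀ t ∈ Ico t₀ T, IsDissipativePair N c D F (X t) (Y t)) :
    Real.exp (c * T) * N (X T - Y T) ≤ Real.exp (c * t₀) * N (X t₀ - Y t₀) := by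
  have hψ : AbsolutelyContinuousOnInterval (fun t => N (X t - Y t)) t₀ T :=
    ((hX.absolutelyContinuous T hT).fun_sub (hY.absolutelyContinuous T hT)).seminorm_comp N
  have hexp : AbsolutelyContinuousOnInterval (fun t => Real.exp (c * t)) t₀ T :=
    ContDiffOn.absolutelyContinuousOnInterval (by fun_prop)
  have hφ := hexp.fun_mul hψ
  have hint := hφ.integral_deriv_eq_sub
  have hle : ∫ t in t₀..T, deriv (fun t => Real.exp (c * t) * N (X t - Y t)) t ≤ 0 := by
    rw [intervalIntegral.integral_of_le hT]
    refine integral_nonpos_of_ae ?_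
    have hsub : Ioc t₀ T ⊆ Ici t₀ := fun t ht => ht.1.le
    have hTne : ∀ᵐ t ∂(volume : Measure ℝ), t ≠ T := by simp [ae_iff, measure_singleton]
    filter_upwards [ae_restrict_of_ae_restrict_of_subset hsub hX.inclusion,
      ae_restrict_of_ae_restrict_of_subset hsub hY.inclusion,
      ae_restrict_of_ae hψ.ae_differentiableAt, ae_restrict_of_ae hTne,
      ae_restrict_mem measurableSet_Ioc] with t hXt hYt hd hne ht
    obtain ⟨v, hv, hXd⟩ := hXt
    obtain ⟨w, hw, hYd⟩ := hYt
    have hd' := (hd (by rw [uIcc_of_le hT]; exact ⟨ht.1.le, ht.2⟩)).hasDerivAt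
    have h1 := deriv_seminorm_le (hXd.fun_sub hYd) hd'
      (hgood t ⟨ht.1.le, lt_of_le_of_ne ht.2 hne⟩ v hv w hw)
    have h2 : HasDerivAt (fun t => Real.exp (c * t)) (Real.exp (c * t) * c) t := by
      simpa using ((hasDerivAt_id t).const_mul c).exp
    rw [(h2.fun_mul hd').deriv]
    have := mul_le_mul_of_nonneg_left h1 (Real.exp_pos (c * t)).le
    simp only [Pi.zero_apply]
    linarith
  linarith

/-! ### From local to global contraction -/

theorem IsFilippovSolution.exists_tube {t₀ T : ℝ} (hN : IsNorm N) (hc : 0 < c)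
    (hloc : ∀ p ∈ U, ∃ V, IsOpen V ∧ p ∈ V ∧ ∀ x ∈ V, ∀ y ∈ V, IsDissipativePair N c D F x y)
    {X : ℝ → Fin n → ℝ} (hX : IsFilippovSolution U D F t₀ X) (hT : t₀ ≤ T) :
    ∃ δ > 0, ∀ Y, IsFilippovSolution U D F t₀ Y → N (X t₀ - Y t₀) < δ →
      N (X T - Y T) ≤ Real.exp (-c * (T - t₀)) * N (X t₀ - Y t₀) := by
  choose! V hVo hpV hV using hloc
  have hcont : ∀ {Y : ℝ → Fin n → ℝ}, IsFilippovSolution U D F t₀ Y → ContinuousOn Y (Icc t₀ T) :=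
    fun hY => uIcc_of_le hT ▸ (hY.absolutelyContinuous T hT).continuousOn
  -- A Lebesgue number of the cover of the compact trajectory gives a tube of uniform width; `k`
  -- converts it to the norm `N`.
  obtain ⟨δ, hδ, hball⟩ := lebesgue_number_lemma_of_metric (s := X '' Icc t₀ T)
    (c := fun p : U => V p) (isCompact_Icc.image_of_continuousOn (hcont hX))
    (fun p => hVo p p.2) (by
      rintro _ ⟨t, ht, rfl⟩
      exact mem_iUnion.2 ⟨⟨X t, hX.mem t ht.1⟩, hpV _ (hX.mem t ht.1)⟩)
  obtain ⟨k, hk, hkN⟩ := hN.exists_le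
  refine ⟨k * δ, by positivity, fun Y hY h0 => ?_⟩
  have hgood : ∀ t ∈ Icc t₀ T, N (X t - Y t) < k * δ → IsDissipativePair N c D F (X t) (Y t) := by
    intro t ht hlt
    obtain ⟨p, hp⟩ := hball (X t) ⟨t, ht, rfl⟩
    refine hV p p.2 _ (hp (Metric.mem_ball_self hδ)) _ (hp ?_)
    rw [Metric.mem_ball', dist_eq_norm]
    exact lt_of_mul_lt_mul_left ((hkN _).trans_lt hlt) hk.le
  have hsmall : ∀ t ∈ Icc t₀ T, N (X t - Y t) < k * δ := by
    by_contra! hbad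
    set B : Set ℝ := Icc t₀ T ∩ (fun t => N (X t - Y t)) ⁻¹' Ici (k * δ) with hB
    have hBc : IsClosed B := ((continuous_seminorm N).comp_continuousOn
      ((hcont hX).sub (hcont hY))).preimage_isClosed_of_isClosed isClosed_Icc isClosed_Ici
    have hBne : B.Nonempty := by
      obtain ⟨t, ht, h1⟩ := hbad
      exact ⟨t, ht, h1⟩
    have hBb : BddBelow B := ⟨t₀, fun t ht => ht.1.1⟩
    have hτ := hBc.csInf_mem hBne hBb
    set τ := sInf B
    have h1 := hX.exp_mul_le hY hτ.1.1 (N := N) (c := c) fun t ht =>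
      hgood t ⟨ht.1, ht.2.le.trans hτ.1.2⟩ (not_le.1 fun h2 =>
        absurd (csInf_le hBb ⟨⟨ht.1, ht.2.le.trans hτ.1.2⟩, h2⟩) (not_le.2 ht.2))
    -- At the first exit time `τ` the distance would be at least `k * δ`, yet it has not grown since
    -- `t₀`, where it was smaller.
    have h2 : Real.exp (c * t₀) ≤ Real.exp (c * τ) :=
      Real.exp_le_exp.2 (mul_le_mul_of_nonneg_left hτ.1.1 hc.le)
    have h3 : Real.exp (c * τ) * N (X τ - Y τ) ≤ Real.exp (c * τ) * N (X t₀ - Y t₀) :=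
      h1.trans (mul_le_mul_of_nonneg_right h2 (apply_nonneg N _))
    have h4 := le_of_mul_le_mul_left h3 (Real.exp_pos _)
    have h5 : k * δ ≤ N (X τ - Y τ) := hτ.2
    linarith
  have h1 := hX.exp_mul_le hY hT (N := N) (c := c) fun t ht =>
    hgood t ⟨ht.1, ht.2.le⟩ (hsmall t ⟨ht.1, ht.2.le⟩)
  have e : Real.exp (-c * (T - t₀)) = (Real.exp (c * T))⁻¹ * Real.exp (c * t₀) := by
    rw [← Real.exp_neg, ← Real.exp_add]
    congr 1
    ring
  rw [e, mul_assoc, le_inv_mul_iff₀ (Real.exp_pos _)]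
  exact h1

/-- Local dissipativity of a Filippov system on `U` implies incremental exponential stability in
`K`-reachable forward invariant sets. -/
theorem isIncrementallyExpStable_of_dissipative (hN : IsNorm N) (hc : 0 < c)
    (hloc : ∀ p ∈ U, ∃ V, IsOpen V ∧ p ∈ V ∧ ∀ x ∈ V, ∀ y ∈ V, IsDissipativePair N c D F x y)
    {C : Set (Fin n → ℝ)} {K : ℝ} (hC : IsKReachable N K C)
    (hinv : IsForwardInvariant (IsFilippovSolution U D F) C) :
    IsIncrementallyExpStable N (IsFilippovSolution U D F) C c := by
  -- The stability constant must be at least one, whereas `K` need not be.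
  refine ⟨hinv, hc, max 1 K, le_max_left _ _, fun t₀ x y hx hy hx₀ hy₀ t ht => ?_⟩
  set e := Real.exp (-c * (t - t₀)) with he
  have he0 : 0 ≤ e := (Real.exp_pos _).le
  obtain ⟨γ, hγ, hγC, hγ0, hγ1, hγK⟩ := hC _ hx₀ _ hy₀
  have hsol : ∀ r, ∃ X, r ∈ Icc (0 : ℝ) 1 → IsFilippovSolution U D F t₀ X ∧ X t₀ = γ r := by
    intro r
    by_cases hr : r ∈ Icc (0 : ℝ) 1
    · obtain ⟨X, hX⟩ := (hinv t₀ _ (hγC hr)).1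
      exact ⟨X, fun _ => hX⟩
    · exact ⟨x, fun h => absurd h hr⟩
  -- Solutions are selected arbitrarily: the tube estimate controls the dependence on `r`, and
  -- uniqueness matters only at the two ends.
  choose P hP using hsol
  have huniq : ∀ {X Y : ℝ → Fin n → ℝ}, IsFilippovSolution U D F t₀ X →
      IsFilippovSolution U D F t₀ Y → X t₀ = Y t₀ → N (X t - Y t) = 0 := by
    intro X Y hX hY h0
    obtain ⟨δ, hδ, htube⟩ := hX.exists_tube hN hc hloc ht
    have h1 : N (X t₀ - Y t₀) = 0 := by rw [h0, sub_self, map_zero]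
    have h2 := htube Y hY (h1.trans_lt hδ)
    rw [h1, mul_zero] at h2
    exact le_antisymm h2 (apply_nonneg N _)
  set M := K * N (y t₀ - x t₀) with hM
  have hmvt : ∀ r ∈ Icc (0 : ℝ) 1, ∀ s ∈ Icc (0 : ℝ) 1, N (γ s - γ r) ≤ M * |s - r| :=
    fun r hr s hs => seminorm_sub_le_of_derivWithin_le (hγ.differentiableOn one_ne_zero) hγK hr hs
  -- The tube width depends on `r`, so only nearby solutions can be compared; the monotonicity
  -- criterion sums these comparisons to the total bound `e * M`.
  have hanti := le_of_eventually_antitone (Ψ := fun r => N (P r t - x t) - e * M * r)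
    zero_le_one (by
      intro r hr
      obtain ⟨hPr, hPr0⟩ := hP r hr
      obtain ⟨δ, hδ, htube⟩ := hPr.exists_tube hN hc hloc ht
      have hnear : ∀ᶠ s in 𝓝[Icc 0 1] r, N (γ r - γ s) < δ := by
        have : ContinuousWithinAt (fun s => N (γ r - γ s)) (Icc 0 1) r :=
          (continuous_seminorm N).continuousAt.comp_continuousWithinAt
            (continuousWithinAt_const.sub (hγ.continuousOn r hr))
        refine this.eventually (gt_mem_nhds ?_)
        simpa only [sub_self, map_zero] using hδ
      filter_upwards [hnear, self_mem_nhdsWithin] with s hs hsI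
      obtain ⟨hPs, hPs0⟩ := hP s hsI
      have h1 := htube _ hPs (by rwa [hPr0, hPs0])
      rw [hPr0, hPs0, map_sub_rev N (γ r)] at h1
      have h2 : N (P r t - P s t) ≤ e * M * |s - r| := by
        rw [mul_assoc]
        exact h1.trans (mul_le_mul_of_nonneg_left (hmvt r hr s hsI) he0)
      have h3 := (abs_seminorm_sub_le N (P r t - x t) (P s t - x t))
      rw [sub_sub_sub_cancel_right] at h3
      have h4 := abs_le.1 (h3.trans h2)
      constructor
      · intro h
        rw [abs_of_pos (sub_pos.2 h)] at h4
        linarith [h4.1]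
      · intro h
        rw [abs_of_neg (sub_neg.2 h)] at h4
        linarith [h4.2])
  obtain ⟨hP0, hP00⟩ := hP 0 (by simp)
  obtain ⟨hP1, hP10⟩ := hP 1 (by simp)
  have h0 : N (P 0 t - x t) = 0 := huniq hP0 hx (by rw [hP00, hγ0])
  have h1 : N (y t - P 1 t) = 0 := huniq hy hP1 (by rw [hP10, hγ1])
  simp only [h0, mul_one, mul_zero, sub_zero] at hanti
  have h2 : N (y t - x t) ≤ N (y t - P 1 t) + N (P 1 t - x t) := by
    rw [← sub_add_sub_cancel (y t) (P 1 t) (x t)]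
    exact map_add_le_add N _ _
  rw [map_sub_rev N (x t), map_sub_rev N (x t₀)]
  calc N (y t - x t) ≤ e * M := by linarith
    _ = K * e * N (y t₀ - x t₀) := by rw [hM]; ring
    _ ≤ max 1 K * e * N (y t₀ - x t₀) := by
        refine mul_le_mul_of_nonneg_right ?_ (apply_nonneg N _)
        exact mul_le_mul_of_nonneg_right (le_max_right _ _) he0

end SwitchedControl

theorem theorem3 {n m : ℕ}
    -- the domain, the control system and the switching feedback
    (U : Set (Fin n → ℝ)) (hU : IsOpen U)
    (f : (Fin n → ℝ) → Fin n → ℝ) (hf : ContDiffOn ℝ 1 f U)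
    (g : (Fin n → ℝ) → Matrix (Fin n) (Fin m) ℝ)
    (hg : ∀ i j, ContDiffOn ℝ 1 (fun x => g x i j) U)
    (uPos uNeg : (Fin n → ℝ) → Fin m → ℝ)
    (huPos : ContDiffOn ℝ 1 uPos U) (huNeg : ContDiffOn ℝ 1 uNeg U)
    -- the switching function, with regular value zero
    (H : (Fin n → ℝ) → ℝ) (hH : ContDiffOn ℝ 1 H U)
    (hreg : ∀ x ∈ SwitchedControl.switchingManifold U H, SwitchedControl.grad H x ≠ 0)
    -- the norm and the set
    (N : Seminorm ℝ (Fin n → ℝ)) (hN : SwitchedControl.IsNorm N)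
    (C : Set (Fin n → ℝ)) (hCU : C ⊆ U)
    (K : ℝ) (hK : 0 < K) (hC : SwitchedControl.IsKReachable N K C)
    (hinv : SwitchedControl.IsForwardInvariant
      (SwitchedControl.IsClosedLoopSolution U f g uPos uNeg H) C)
    -- the three conditions on the matrix measure
    (c₁ c₂ : ℝ) (hc₁ : 0 < c₁) (hc₂ : 0 < c₂)
    (hpos : ∀ x ∈ closure (SwitchedControl.regionPos U H) ∩ U,
      SwitchedControl.matrixMeasure N (SwitchedControl.jacobian f x
        + SwitchedControl.jacobian (fun y => (g y).mulVec (uPos y)) x) ≤ -c₁)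
    (hneg : ∀ x ∈ closure (SwitchedControl.regionNeg U H) ∩ U,
      SwitchedControl.matrixMeasure N (SwitchedControl.jacobian f x
        + SwitchedControl.jacobian (fun y => (g y).mulVec (uNeg y)) x) ≤ -c₂)
    (hjump : ∀ x ∈ SwitchedControl.switchingManifold U H,
      SwitchedControl.matrixMeasure N (Matrix.vecMulVec ((g x).mulVec (uPos x - uNeg x))
        (SwitchedControl.grad H x)) = 0) :
    SwitchedControl.IsIncrementallyExpStable N
      (SwitchedControl.IsClosedLoopSolution U f g uPos uNeg H) C (min c₁ c₂) := by
  have hc : 0 < min c₁ c₂ := lt_min hc₁ hc₂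
  refine SwitchedControl.isIncrementallyExpStable_of_dissipative hN hc (fun p hp => ?_) hC hinv
  obtain ⟨V, d, hpV, hVU, hV⟩ := SwitchedControl.exists_isPiecewiseContracting hU hf hg huPos huNeg
    hH hreg hN hpos hneg hjump hp
  have hsub := fun x (hx : x ∈ V) =>
    SwitchedControl.filippovMap_subset_admissibleValues (U := U) (hV.diff_pos x hx).continuousAt
      (hV.diff_neg x hx).continuousAt (hV.diff_switch x hx).continuousAt
  exact ⟨V, hV.isOpen, hpV, fun x hx y hy v hv w hw h hh =>
    hV.dissipative hx hy (hsub x hx hv) (hsub y hy hw) hh⟩
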